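/- A finite group $G$ with commutator subgroup $G' = [G,G]$ is called a Camina group if, for every $g \in G \setminus G'$, the conjugacy class of $g$ is the coset $gG'$. A Camina $p$-group is a Camina group that is also a $p$-group. For every odd prime $p$, there exists a (finite) Camina $p$-group $G$ of nilpotence class exactly $3$ such that $C_G(G') = G'$. -/

import Mathlib

open scoped Pointwise

/-- A group `G` is a Camina group if the conjugacy class of every `g ∈ G \ G'` is the coset `gG'`,
where `G'` is the commutator subgroup. (Finiteness is required separately.) -/
def IsCaminaGroup (G : Type*) [Group G] : Prop :=
  ∀ g : G, g ∉ commutator G → conjugatesOf g = g • (commutator G : Set G)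

/-- A Camina `p`-group: a finite group that is both a Camina group and a `p`-group. -/
structure IsCaminaPGroup (p : ℕ) (G : Type*) [Group G] : Prop where
  finite : Finite G
  isPGroup : IsPGroup p G
  isCamina : IsCaminaGroup G

/-- The underlying set of a twisted quotient of the group of `K`-points of the free nilpotent group
of class three on two generators. Here `T`, `P` are the coordinates of a quadratic extension `K` of
`F`. -/
@[ext]
structure TwistedFreeNilpotent {F K : Type} [Field F] [Field K] [Algebra F K]
    (T P : K →ₗ[F] F) (γ : F) : Type where
  a : K
  b : K
  c : K
  d : F
  e : F

namespace TwistedFreeNilpotent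

variable {F K : Type} [Field F] [Field K] [Algebra F K] {T P : K →ₗ[F] F} {γ : F}

instance : Mul (TwistedFreeNilpotent T P γ) where
  mul x y :=
    { a := x.a + y.a
      b := x.b + y.b
      c := x.c + y.c + y.a * x.b
      d := x.d + y.d + T (2 * x.c * y.a + x.b * y.a ^ 2) - γ * (T x.b * P y.b)
      e := x.e + y.e + T (y.a * x.b ^ 2 + 2 * (y.a * x.b + x.c) * y.b)
        + (T x.a * P y.a - T x.b * P y.b) }

instance : One (TwistedFreeNilpotent T P γ) where
  one := ⟨0, 0, 0, 0, 0⟩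

instance : Inv (TwistedFreeNilpotent T P γ) where
  inv x :=
    { a := -x.a
      b := -x.b
      c := x.a * x.b - x.c
      d := -x.d - T (2 * (x.a * x.b - x.c) * x.a - x.b * x.a ^ 2) - γ * (T x.b * P x.b)
      e := -x.e - T (x.a * x.b ^ 2 - 2 * x.c * x.b) + (T x.a * P x.a - T x.b * P x.b) }

variable (x y : TwistedFreeNilpotent T P γ)

@[simp] lemma mul_a : (x * y).a = x.a + y.a := rfl

@[simp] lemma mul_b : (x * y).b = x.b + y.b := rfl

@[simp] lemma mul_c : (x * y).c = x.c + y.c + y.a * x.b := rfl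

@[simp] lemma mul_d : (x * y).d =
    x.d + y.d + T (2 * x.c * y.a + x.b * y.a ^ 2) - γ * (T x.b * P y.b) := rfl

@[simp] lemma mul_e : (x * y).e =
    x.e + y.e + T (y.a * x.b ^ 2 + 2 * (y.a * x.b + x.c) * y.b)
      + (T x.a * P y.a - T x.b * P y.b) := rfl

@[simp] lemma one_a : (1 : TwistedFreeNilpotent T P γ).a = 0 := rfl

@[simp] lemma one_b : (1 : TwistedFreeNilpotent T P γ).b = 0 := rfl

@[simp] lemma one_c : (1 : TwistedFreeNilpotent T P γ).c = 0 := rfl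

@[simp] lemma one_d : (1 : TwistedFreeNilpotent T P γ).d = 0 := rfl

@[simp] lemma one_e : (1 : TwistedFreeNilpotent T P γ).e = 0 := rfl

@[simp] lemma inv_a : x⁻¹.a = -x.a := rfl

@[simp] lemma inv_b : x⁻¹.b = -x.b := rfl

lemma inv_c : x⁻¹.c = x.a * x.b - x.c := rfl

lemma inv_d : x⁻¹.d =
    -x.d - T (2 * (x.a * x.b - x.c) * x.a - x.b * x.a ^ 2) - γ * (T x.b * P x.b) := rfl

lemma inv_e : x⁻¹.e =
    -x.e - T (x.a * x.b ^ 2 - 2 * x.c * x.b) + (T x.a * P x.a - T x.b * P x.b) := rfl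

instance : Group (TwistedFreeNilpotent T P γ) :=
  Group.ofLeftAxioms
    (by
      intro x y z
      ext
      · simp [add_assoc]
      · simp [add_assoc]
      · simp only [mul_a, mul_b, mul_c]; ring
      · simp only [mul_a, mul_b, mul_c, mul_d, map_add]
        have h : T (2 * (x.c + y.c + y.a * x.b) * z.a) + T ((x.b + y.b) * z.a ^ 2)
              + T (2 * x.c * y.a) + T (x.b * y.a ^ 2)
            = T (2 * x.c * (y.a + z.a)) + T (x.b * (y.a + z.a) ^ 2)
              + T (2 * y.c * z.a) + T (y.b * z.a ^ 2) := by
          simp only [← map_add]; congr 1; ring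
        linear_combination h
      · simp only [mul_a, mul_b, mul_c, mul_e, map_add]
        have h : T (y.a * x.b ^ 2) + T (2 * (y.a * x.b + x.c) * y.b)
              + T (z.a * (x.b + y.b) ^ 2)
              + T (2 * (z.a * (x.b + y.b) + (x.c + y.c + y.a * x.b)) * z.b)
            = T (z.a * y.b ^ 2) + T (2 * (z.a * y.b + y.c) * z.b)
              + T ((y.a + z.a) * x.b ^ 2)
              + T (2 * ((y.a + z.a) * x.b + x.c) * (y.b + z.b)) := by
          simp only [← map_add]; congr 1; ring
        linear_combination h)
    (by intro x; ext <;> simp)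
    (by
      intro x
      ext
      · simp
      · simp
      · simp only [mul_c, inv_c, inv_b, one_c]; ring
      · simp only [mul_d, inv_c, inv_b, inv_d, one_d, map_neg]
        have h : T (2 * (x.a * x.b - x.c) * x.a + -x.b * x.a ^ 2)
            = T (2 * (x.a * x.b - x.c) * x.a - x.b * x.a ^ 2) := by congr 1; ring
        linear_combination h
      · simp only [mul_e, inv_c, inv_b, inv_a, inv_e, one_e, map_neg]
        have h : T (x.a * (-x.b) ^ 2 + 2 * (x.a * -x.b + (x.a * x.b - x.c)) * x.b)
            = T (x.a * x.b ^ 2 - 2 * x.c * x.b) := by congr 1; ring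
        linear_combination h)

variable (T P γ) in
/-- The projection onto the first two coordinates. -/
def toProd : TwistedFreeNilpotent T P γ →* Multiplicative (K × K) where
  toFun x := Multiplicative.ofAdd (x.a, x.b)
  map_one' := rfl
  map_mul' _ _ := rfl

lemma mem_ker_toProd : x ∈ (toProd T P γ).ker ↔ x.a = 0 ∧ x.b = 0 := by
  rw [MonoidHom.mem_ker]
  exact Prod.ext_iff

variable (T P γ) in
/-- The equivalence with the product of the coordinates. -/
def equivProd : TwistedFreeNilpotent T P γ ≃ K × K × K × F × F where
  toFun x := (x.a, x.b, x.c, x.d, x.e)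
  invFun x := ⟨x.1, x.2.1, x.2.2.1, x.2.2.2.1, x.2.2.2.2⟩
  left_inv _ := rfl
  right_inv _ := rfl

end TwistedFreeNilpotent

section Algebra

variable {F K : Type} [Field F] [Field K] [Algebra F K]

lemma LinearMap.eq_zero_of_forall_apply_mul_eq_zero {T : K →ₗ[F] F} (hT : T ≠ 0) {a : K}
    (h : ∀ c, T (c * a) = 0) : a = 0 := by
  by_contra ha
  refine hT (LinearMap.ext fun y => ?_)
  simpa [ha] using h (y * a⁻¹)

lemma LinearMap.exists_apply_mul_eq {T : K →ₗ[F] F} (hT : T ≠ 0) {a : K} (ha : a ≠ 0) (u : F) :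
    ∃ c, T (c * a) = u := by
  obtain ⟨c, hc⟩ : ∃ c, T (c * a) ≠ 0 := by
    by_contra! h
    exact ha (eq_zero_of_forall_apply_mul_eq_zero hT h)
  refine ⟨(u / T (c * a)) • c, ?_⟩
  rw [smul_mul_assoc, map_smul, smul_eq_mul, div_mul_cancel₀ _ hc]

lemma LinearMap.exists_apply_mul_eq_pair {T : K →ₗ[F] F} (hT : T ≠ 0) {a b : K}
    (hab : ∀ s t : F, s • a + t • b = 0 → s = 0 ∧ t = 0) (u v : F) :
    ∃ c, T (c * a) = u ∧ T (c * b) = v := by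
  let f : K →ₗ[F] F × F :=
    (T ∘ₗ LinearMap.mulRight F a).prod (T ∘ₗ LinearMap.mulRight F b)
  have hf : LinearMap.range f = ⊤ := by
    by_contra h
    obtain ⟨g, hg, hle⟩ := Submodule.exists_le_ker_of_lt_top _ (lt_top_iff_ne_top.2 h)
    have hg' : ∀ x y : F, g (x, y) = x * g (1, 0) + y * g (0, 1) := by
      intro x y
      rw [← smul_eq_mul, ← smul_eq_mul, ← map_smul, ← map_smul, ← map_add]
      simp
    have h0 : g (1, 0) • a + g (0, 1) • b = 0 := by
      refine eq_zero_of_forall_apply_mul_eq_zero hT fun c => ?_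
      have := hle ⟨c, rfl⟩
      rw [LinearMap.mem_ker] at this
      change g (T (c * a), T (c * b)) = 0 at this
      rw [hg'] at this
      rw [mul_add, mul_smul_comm, mul_smul_comm, map_add, map_smul, map_smul, smul_eq_mul,
        smul_eq_mul]
      linear_combination this
    obtain ⟨h1, h2⟩ := hab _ _ h0
    refine hg (LinearMap.ext fun z => ?_)
    rw [← Prod.mk.eta (p := z), hg', h1, h2]
    simp
  obtain ⟨c, hc⟩ := LinearMap.range_eq_top.1 hf (u, v)
  exact ⟨c, congrArg Prod.fst hc, congrArg Prod.snd hc⟩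

lemma exists_eq_smul_of_smul_add_smul_eq_zero {a b : K} {s t : F} (hst : ¬(s = 0 ∧ t = 0))
    (h : s • a + t • b = 0) : ∃ α : K, a = t • α ∧ b = -(s • α) := by
  by_cases ht : t = 0
  · subst ht
    have hs : s ≠ 0 := fun hs => hst ⟨hs, rfl⟩
    have ha : a = 0 := by simpa [hs] using h
    exact ⟨-(s⁻¹ • b), by simp [ha], by rw [smul_neg, smul_inv_smul₀ hs, neg_neg]⟩
  · refine ⟨t⁻¹ • a, (smul_inv_smul₀ ht a).symm, ?_⟩
    rw [smul_comm, ← smul_neg, eq_inv_smul_iff₀ ht, eq_neg_iff_add_eq_zero, add_comm, h]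

lemma exists_mul_apply_sub_mul_apply_eq {T P : K →ₗ[F] F}
    (hsurj : ∀ u v : F, ∃ x, T x = u ∧ P x = v) (hinj : ∀ x, T x = 0 → P x = 0 → x = 0)
    {α : K} (hα : α ≠ 0) (u : F) : ∃ k, T (k * α) * P α - P (k * α) * T α = u := by
  by_cases hT : T α = 0
  · have hP : P α ≠ 0 := fun hP => hα (hinj α hT hP)
    obtain ⟨x, hx, -⟩ := hsurj (u / P α) 0
    refine ⟨x / α, ?_⟩
    rw [div_mul_cancel₀ _ hα, hx, hT]
    field_simp
    ring
  · obtain ⟨x, hx, hx'⟩ := hsurj 0 (-u / T α)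
    refine ⟨x / α, ?_⟩
    rw [div_mul_cancel₀ _ hα, hx, hx']
    field_simp
    ring

lemma exists_commutator_equations {T P : K →ₗ[F] F} {γ : F} (h2 : (2 : F) ≠ 0)
    (hsurj : ∀ u v : F, ∃ x, T x = u ∧ P x = v) (hinj : ∀ x, T x = 0 → P x = 0 → x = 0)
    (hγ : ∀ s t : F, t ^ 3 - t * s ^ 2 - γ * s ^ 3 = 0 → s = 0 ∧ t = 0)
    {a b : K} (hab : ¬(a = 0 ∧ b = 0)) (m w : K) (z₁ z₂ : F) :
    ∃ a' b' c' : K, a * b' - a' * b = w ∧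
      T (2 * c' * a + b' * a ^ 2 - 2 * m * a' - b * a' ^ 2)
        - γ * (T b' * P b - T b * P b') = z₁ ∧
      T (a * b' ^ 2 + 2 * (a * b' + c') * b - a' * b ^ 2 - 2 * (a' * b + m) * b')
        + ((T a' * P a - T a * P a') - (T b' * P b - T b * P b')) = z₂ := by
  have hT : T ≠ 0 := by
    rintro rfl
    obtain ⟨x, hx, -⟩ := hsurj 1 0
    simp at hx
  have hT2 : ∀ x, T (2 * x) = 2 * T x := fun x => by rw [two_mul, map_add, two_mul]
  obtain ⟨a₀, b₀, h₀⟩ : ∃ a₀ b₀ : K, a * b₀ - a₀ * b = w := by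
    by_cases ha : a = 0
    · have hb : b ≠ 0 := fun hb => hab ⟨ha, hb⟩
      exact ⟨-w / b, 0, by field_simp; simp [ha]⟩
    · exact ⟨0, w / a, by field_simp; simp⟩
  by_cases hind : ∀ s t : F, s • a + t • b = 0 → s = 0 ∧ t = 0
  · obtain ⟨c, hc₁, hc₂⟩ := LinearMap.exists_apply_mul_eq_pair hT hind
      ((z₁ - (T (b₀ * a ^ 2 - 2 * m * a₀ - b * a₀ ^ 2)
        - γ * (T b₀ * P b - T b * P b₀))) / 2)
      ((z₂ - (T (a * b₀ ^ 2 + 2 * (a * b₀) * b - a₀ * b ^ 2 - 2 * (a₀ * b + m) * b₀)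
        + ((T a₀ * P a - T a * P a₀) - (T b₀ * P b - T b * P b₀)))) / 2)
    rw [eq_div_iff h2] at hc₁ hc₂
    refine ⟨a₀, b₀, c, h₀, ?_, ?_⟩
    · rw [show 2 * c * a + b₀ * a ^ 2 - 2 * m * a₀ - b * a₀ ^ 2
        = 2 * (c * a) + (b₀ * a ^ 2 - 2 * m * a₀ - b * a₀ ^ 2) by ring, map_add, hT2]
      linear_combination hc₁
    · rw [show a * b₀ ^ 2 + 2 * (a * b₀ + c) * b - a₀ * b ^ 2 - 2 * (a₀ * b + m) * b₀
        = 2 * (c * b) + (a * b₀ ^ 2 + 2 * (a * b₀) * b - a₀ * b ^ 2 - 2 * (a₀ * b + m) * b₀)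
        by ring, map_add, hT2]
      linear_combination hc₂
  · push Not at hind
    obtain ⟨s, t, hst, hne⟩ := hind
    have hne' : ¬(s = 0 ∧ t = 0) := fun h => hne h.1 h.2
    obtain ⟨α, rfl, rfl⟩ := exists_eq_smul_of_smul_add_smul_eq_zero hne' hst
    have hα : α ≠ 0 := by
      rintro rfl
      simp at hab
    have hN : t ^ 3 - t * s ^ 2 - γ * s ^ 3 ≠ 0 := fun h => hne' (hγ s t h)
    set σ := algebraMap F K s with hσ
    set τ := algebraMap F K t with hτ
    have hTl : ∀ x y, s * T x + t * T y = T (σ * x + τ * y) := fun x y => by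
      rw [map_add, hσ, hτ, ← Algebra.smul_def, ← Algebra.smul_def, map_smul, map_smul,
        smul_eq_mul, smul_eq_mul]
    have hTt : ∀ x, T (τ * x) = t * T x := fun x => by
      rw [← Algebra.smul_def, map_smul, smul_eq_mul]
    have hTs : ∀ x, T (σ * x) = s * T x := fun x => by
      rw [← Algebra.smul_def, map_smul, smul_eq_mul]
    have hPt : ∀ x, P (τ * x) = t * P x := fun x => by
      rw [← Algebra.smul_def, map_smul, smul_eq_mul]
    have hPs : ∀ x, P (σ * x) = s * P x := fun x => by
      rw [← Algebra.smul_def, map_smul, smul_eq_mul]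
    rw [Algebra.smul_def, Algebra.smul_def, ← hσ, ← hτ] at h₀ ⊢
    set A := τ * α with hA
    set B := -(σ * α) with hB
    let E₁ : K → K → K := fun a' b' => b' * A ^ 2 - 2 * m * a' - B * a' ^ 2
    let E₂ : K → K → K := fun a' b' =>
      A * b' ^ 2 + 2 * (A * b') * B - a' * B ^ 2 - 2 * (a' * B + m) * b'
    let R₁ : K → K → F := fun a' b' =>
      z₁ - (T (E₁ a' b') - γ * (T b' * P B - T B * P b'))
    let R₂ : K → K → F := fun a' b' =>
      z₂ - (T (E₂ a' b') + ((T a' * P A - T A * P a') - (T b' * P B - T B * P b')))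
    obtain ⟨k, hk⟩ := exists_mul_apply_sub_mul_apply_eq hsurj hinj hα
      ((s * R₁ a₀ b₀ + t * R₂ a₀ b₀) / (t ^ 3 - t * s ^ 2 - γ * s ^ 3))
    rw [eq_div_iff hN] at hk
    have hkA : k * A = τ * (k * α) := by rw [hA]; ring
    have hkB : k * B = -(σ * (k * α)) := by rw [hB]; ring
    have hE : s * T (E₁ (a₀ + k * A) (b₀ + k * B)) + t * T (E₂ (a₀ + k * A) (b₀ + k * B))
        = s * T (E₁ a₀ b₀) + t * T (E₂ a₀ b₀) := by
      rw [hTl, hTl]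
      congr 1
      simp only [E₁, E₂, hA, hB]
      ring
    have hR : s * R₁ (a₀ + k * A) (b₀ + k * B) + t * R₂ (a₀ + k * A) (b₀ + k * B) = 0 := by
      simp only [R₁, R₂, map_add] at hk ⊢
      rw [hkA, hkB] at hE ⊢
      simp only [hA, hB, map_neg, hTt, hTs, hPt, hPs] at hk hE ⊢
      linear_combination -hE - hk
    obtain ⟨ρ, hρ₁, hρ₂⟩ := exists_eq_smul_of_smul_add_smul_eq_zero hne' hR
    obtain ⟨c, hc⟩ := LinearMap.exists_apply_mul_eq hT hα (ρ / 2)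
    rw [eq_div_iff h2] at hc
    refine ⟨a₀ + k * A, b₀ + k * B, c, ?_, ?_, ?_⟩
    · linear_combination h₀
    · have : T (2 * c * A + (b₀ + k * B) * A ^ 2 - 2 * m * (a₀ + k * A) - B * (a₀ + k * A) ^ 2)
          = t * (2 * T (c * α)) + T (E₁ (a₀ + k * A) (b₀ + k * B)) := by
        rw [← hT2, ← hTt, ← map_add]
        congr 1
        simp only [E₁, hA]
        ring
      rw [this]
      simp only [R₁, smul_eq_mul] at hρ₁
      linear_combination t * hc - hρ₁
    · have : T (A * (b₀ + k * B) ^ 2 + 2 * (A * (b₀ + k * B) + c) * B - (a₀ + k * A) * B ^ 2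
            - 2 * ((a₀ + k * A) * B + m) * (b₀ + k * B))
          = -(s * (2 * T (c * α))) + T (E₂ (a₀ + k * A) (b₀ + k * B)) := by
        rw [← hT2, ← hTs, ← map_neg, ← map_add]
        congr 1
        simp only [E₂, hB]
        ring
      rw [this]
      simp only [R₂, smul_eq_mul] at hρ₂
      linear_combination -s * hc - hρ₂

end Algebra

namespace TwistedFreeNilpotent

open scoped commutatorElement

variable {F K : Type} [Field F] [Field K] [Algebra F K] {T P : K →ₗ[F] F} {γ : F}

lemma exists_mul_eq_mul_mul (h2 : (2 : F) ≠ 0)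
    (hsurj : ∀ u v : F, ∃ x, T x = u ∧ P x = v) (hinj : ∀ x, T x = 0 → P x = 0 → x = 0)
    (hγ : ∀ s t : F, t ^ 3 - t * s ^ 2 - γ * s ^ 3 = 0 → s = 0 ∧ t = 0)
    {g u : TwistedFreeNilpotent T P γ} (hg : g ∉ (toProd T P γ).ker)
    (hu : u ∈ (toProd T P γ).ker) : ∃ h, h * g = g * u * h := by
  rw [mem_ker_toProd] at hg hu
  obtain ⟨a', b', c', h₁, h₂, h₃⟩ :=
    exists_commutator_equations h2 hsurj hinj hγ hg (g.c + u.c) u.c u.d u.e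
  refine ⟨⟨a', b', c', 0, 0⟩, ?_⟩
  ext
  · simp [hu.1, add_comm]
  · simp [hu.2, add_comm]
  · simp only [mul_b, mul_c, hu.1, hu.2]
    linear_combination h₁
  · simp only [mul_b, mul_c, mul_d, hu.1, hu.2, map_add, map_sub, map_zero, mul_zero,
      zero_mul, add_zero, ne_eq, OfNat.ofNat_ne_zero, not_false_eq_true, zero_pow] at h₂ ⊢
    linear_combination h₂
  · simp only [mul_a, mul_b, mul_c, mul_e, hu.1, hu.2, map_add, map_sub, map_zero, mul_zero,
      zero_mul, add_zero] at h₃ ⊢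
    linear_combination h₃

lemma commutator_eq_ker (hsolve : ∀ g u : TwistedFreeNilpotent T P γ,
      g ∉ (toProd T P γ).ker → u ∈ (toProd T P γ).ker → ∃ h, h * g = g * u * h) :
    commutator (TwistedFreeNilpotent T P γ) = (toProd T P γ).ker := by
  refine le_antisymm (Abelianization.commutator_subset_ker _) fun u hu => ?_
  obtain ⟨h, hh⟩ := hsolve ⟨1, 0, 0, 0, 0⟩ u
    (by rw [mem_ker_toProd]; simp) hu
  have : u = ⁅(⟨1, 0, 0, 0, 0⟩ : TwistedFreeNilpotent T P γ)⁻¹, h⁆ := by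
    rw [commutatorElement_def, inv_inv, mul_assoc _ h, hh]
    group
  rw [this]
  exact Subgroup.commutator_mem_commutator (Subgroup.mem_top _) (Subgroup.mem_top _)

lemma isCaminaGroup (hsolve : ∀ g u : TwistedFreeNilpotent T P γ,
      g ∉ (toProd T P γ).ker → u ∈ (toProd T P γ).ker → ∃ h, h * g = g * u * h) :
    IsCaminaGroup (TwistedFreeNilpotent T P γ) := by
  intro g hg
  have hker := commutator_eq_ker hsolve
  ext y
  rw [Set.mem_smul_set_iff_inv_smul_mem, smul_eq_mul, SetLike.mem_coe, hker]
  change IsConj g y ↔ _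
  rw [isConj_iff]
  constructor
  · rintro ⟨h, rfl⟩
    rw [mem_ker_toProd]
    constructor <;> simp
  · intro hy
    obtain ⟨h, hh⟩ := hsolve g _ (hker ▸ hg) hy
    exact ⟨h, by rw [hh]; group⟩

lemma centralizer_ker (h2 : (2 : F) ≠ 0) (hT : T ≠ 0) :
    Subgroup.centralizer ((toProd T P γ).ker : Set (TwistedFreeNilpotent T P γ))
      = (toProd T P γ).ker := by
  have hT2 : ∀ x, T (2 * x) = 2 * T x := fun x => by rw [two_mul, map_add, two_mul]
  ext g
  rw [Subgroup.mem_centralizer_iff, mem_ker_toProd]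
  constructor
  · intro h
    have h' : ∀ c : K, T (c * g.a) = 0 ∧ T (c * g.b) = 0 := by
      intro c
      have := h ⟨0, 0, c, 0, 0⟩ (by rw [SetLike.mem_coe, mem_ker_toProd]; simp)
      have hd := congrArg TwistedFreeNilpotent.d this
      have he := congrArg TwistedFreeNilpotent.e this
      simp [mul_assoc, hT2, h2] at hd he
      exact ⟨hd, he⟩
    exact ⟨LinearMap.eq_zero_of_forall_apply_mul_eq_zero hT fun c => (h' c).1,
      LinearMap.eq_zero_of_forall_apply_mul_eq_zero hT fun c => (h' c).2⟩
  · rintro ⟨ha, hb⟩ u hu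
    rw [SetLike.mem_coe, mem_ker_toProd] at hu
    ext <;> simp [ha, hb, hu.1, hu.2, add_comm]

lemma commutator_ker_top_le_center :
    ⁅(toProd T P γ).ker, (⊤ : Subgroup (TwistedFreeNilpotent T P γ))⁆ ≤ Subgroup.center _ := by
  refine Subgroup.commutator_le.2 fun x hx y _ => ?_
  rw [mem_ker_toProd] at hx
  have ha : ⁅x, y⁆.a = 0 := by simp [commutatorElement_def]
  have hb : ⁅x, y⁆.b = 0 := by simp [commutatorElement_def]
  have hc : ⁅x, y⁆.c = 0 := by
    simp only [commutatorElement_def, mul_b, mul_c, inv_a, inv_b, inv_c, hx.1, hx.2]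
    ring
  rw [Subgroup.mem_center_iff]
  intro g
  ext <;> simp [ha, hb, hc, add_comm]

lemma nilpotencyClass_eq_three (hker : commutator (TwistedFreeNilpotent T P γ)
    = (toProd T P γ).ker) (h2 : (2 : F) ≠ 0) (hT : T ≠ 0) :
    Group.IsNilpotent (TwistedFreeNilpotent T P γ) ∧
      Group.nilpotencyClass (TwistedFreeNilpotent T P γ) = 3 := by
  have hΓ : Subgroup.lowerCentralSeries (⊤ : Subgroup (TwistedFreeNilpotent T P γ)) 2
      = ⁅(toProd T P γ).ker, ⊤⁆ := by
    rw [Subgroup.lowerCentralSeries_succ, Subgroup.top_lowerCentralSeries_one, hker]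
  have h3 := Subgroup.lowerCentralSeries_succ_eq_bot _ (hΓ.trans_le commutator_ker_top_le_center)
  have hnil : Group.IsNilpotent (TwistedFreeNilpotent T P γ) :=
    Subgroup.nilpotent_iff_lowerCentralSeries.2 ⟨3, h3⟩
  refine ⟨hnil, le_antisymm (Subgroup.lowerCentralSeries_eq_bot_iff_nilpotencyClass_le.1 h3) ?_⟩
  by_contra! h
  have h' := Subgroup.lowerCentralSeries_eq_bot_iff_nilpotencyClass_le.2 (Nat.le_of_lt_succ h)
  rw [hΓ, Subgroup.commutator_comm, Subgroup.commutator_eq_bot_iff_le_centralizer,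
    centralizer_ker h2 hT] at h'
  have := (mem_ker_toProd _).1
    (h' (Subgroup.mem_top (⟨1, 0, 0, 0, 0⟩ : TwistedFreeNilpotent T P γ)))
  exact one_ne_zero this.1

lemma isPGroup (p : ℕ) [Fact p.Prime] (T P : GaloisField p 2 →ₗ[ZMod p] ZMod p) (γ : ZMod p) :
    IsPGroup p (TwistedFreeNilpotent T P γ) := by
  refine IsPGroup.of_card (n := 8) ?_
  rw [Nat.card_congr (equivProd T P γ)]
  simp only [Nat.card_prod, GaloisField.card p 2 two_ne_zero, Nat.card_zmod]
  ring

end TwistedFreeNilpotent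

lemma ZMod.exists_cubic_form_anisotropic (p : ℕ) [Fact p.Prime] :
    ∃ γ : ZMod p, ∀ s t : ZMod p, t ^ 3 - t * s ^ 2 - γ * s ^ 3 = 0 → s = 0 ∧ t = 0 := by
  obtain ⟨γ, hγ⟩ : ∃ γ : ZMod p, ∀ x, x ^ 3 - x ≠ γ := by
    by_contra! h
    have hsurj : Function.Surjective fun x : ZMod p => x ^ 3 - x := h
    exact zero_ne_one (Finite.injective_iff_surjective.2 hsurj (a₁ := 0) (a₂ := 1) (by simp))
  refine ⟨γ, fun s t h => ?_⟩
  by_cases hs : s = 0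
  · subst hs
    exact ⟨rfl, by simpa using h⟩
  · exfalso
    apply hγ (t / s)
    field_simp
    linear_combination h

theorem mainTheorem5 (p : ℕ) (hp : p.Prime) (hodd : Odd p) :
    ∃ (G : Type) (_ : Group G), IsCaminaPGroup p G ∧
      (Group.IsNilpotent G ∧ Group.nilpotencyClass G = 3) ∧
      Subgroup.centralizer (commutator G : Set G) = commutator G := by
  have : Fact p.Prime := ⟨hp⟩
  have h2 : (2 : ZMod p) ≠ 0 := Ring.two_ne_zero <| by
    rw [ZMod.ringChar_zmod_n]
    rintro rfl
    exact absurd hodd (by decide)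
  obtain ⟨γ, hγ⟩ := ZMod.exists_cubic_form_anisotropic p
  let φ : GaloisField p 2 ≃ₗ[ZMod p] ZMod p × ZMod p :=
    LinearEquiv.ofFinrankEq _ _ (by rw [GaloisField.finrank p two_ne_zero]; simp)
  let T := LinearMap.fst (ZMod p) (ZMod p) (ZMod p) ∘ₗ φ.toLinearMap
  let P := LinearMap.snd (ZMod p) (ZMod p) (ZMod p) ∘ₗ φ.toLinearMap
  have hsurj : ∀ u v, ∃ x, T x = u ∧ P x = v := fun u v => ⟨φ.symm (u, v), by simp [T, P]⟩
  have hinj : ∀ x, T x = 0 → P x = 0 → x = 0 := fun x h h' =>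
    φ.map_eq_zero_iff.1 (Prod.ext h h')
  have hT : T ≠ 0 := by
    intro h
    obtain ⟨x, hx, -⟩ := hsurj 1 0
    simp [h] at hx
  have hsolve : ∀ g u : TwistedFreeNilpotent T P γ, g ∉ (TwistedFreeNilpotent.toProd T P γ).ker →
      u ∈ (TwistedFreeNilpotent.toProd T P γ).ker → ∃ h, h * g = g * u * h :=
    fun _ _ => TwistedFreeNilpotent.exists_mul_eq_mul_mul h2 hsurj hinj hγ
  have hker := TwistedFreeNilpotent.commutator_eq_ker hsolve
  refine ⟨TwistedFreeNilpotent T P γ, inferInstance, ⟨?_, ?_, ?_⟩, ?_, ?_⟩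
  · exact Finite.of_equiv _ (TwistedFreeNilpotent.equivProd T P γ).symm
  · exact TwistedFreeNilpotent.isPGroup p T P γ
  · exact TwistedFreeNilpotent.isCaminaGroup hsolve
  · exact TwistedFreeNilpotent.nilpotencyClass_eq_three hker h2 hT
  · rw [hker]
    exact TwistedFreeNilpotent.centralizer_ker h2 hT
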